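/- For $g\in L^2(\mathbb R)$ and $\lambda=(x,\omega)\in\mathbb R^2$ let $\pi(\lambda)g(t)=e^{2\pi i\omega t}g(t-x)$ and, for $f\in L^2(\mathbb R)$, let $V_gf(\lambda)=\langle f,\pi(\lambda)g\rangle=\int_{\mathbb R}f(t)\overline{g(t-x)}e^{-2\pi i\omega t}\,dt$. Feichtinger's algebra is $S_0(\mathbb R)=\{g\in L^2(\mathbb R): V_gg\in L^1(\mathbb R^2)\}$. For a lattice $\Lambda\subset\mathbb R^2$, the Gabor system $\mathcal G(g,\Lambda)=\{\pi(\lambda)g:\lambda\in\Lambda\}$ is a frame for $L^2(\mathbb R)$ if there are constants $0<A\le B<\infty$ with $$A\|f\|^2\le\sum_{\lambda\in\Lambda}|\langle f,\pi(\lambda)g\rangle|^2\le B\|f\|^2\qquad\text{for all } f\in L^2(\mathbb R),$$ and its (sharp) lower frame bound is the supremum of all $A\ge 0$ for which the left inequality holds for all $f\in L^2(\mathbb R)$. **Proposition 5.2.** Let $g\in S_0(\mathbb R)$ be even, i.e. $g(-t)=g(t)$ for almost every $t\in\mathbb R$, and let $\Lambda=S\mathbb Z^2$ with $S\in SL(2,\mathbb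 R)$, i.e. $\Lambda$ is a lattice of density $1$. Then the lower frame bound of $\mathcal G(g,\Lambda)$ is $0$ and, hence, $\mathcal G(g,\Lambda)$ is not a frame for $L^2(\mathbb R)$. -/

import Mathlib

open MeasureTheory
open scoped ENNReal ComplexConjugate

namespace Gabor

/-- The Hilbert space `L²(ℝ)` of complex-valued square-integrable functions (classes modulo
almost everywhere equality). -/
abbrev L2 : Type := Lp ℂ 2 (volume : Measure ℝ)

/-- The time-frequency shift `π(x, ω) g (t) = e^{2π i ω t} g (t - x)` on functions. -/
noncomputable def tfShiftFun (p : ℝ × ℝ) (g : ℝ → ℂ) (t : ℝ) : ℂ :=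
  Complex.exp (2 * Real.pi * Complex.I * p.2 * t) * g (t - p.1)

theorem norm_chirp (w t : ℝ) : ‖Complex.exp (2 * Real.pi * Complex.I * w * t)‖ = 1 := by
  have h : (2 * Real.pi * Complex.I * w * t : ℂ) = ((2 * Real.pi * w * t : ℝ) : ℂ) * Complex.I := by
    push_cast; ring
  rw [h, Complex.norm_exp_ofReal_mul_I]

theorem memLp_tfShiftFun (p : ℝ × ℝ) {g : ℝ → ℂ} (hg : MemLp g 2 volume) :
    MemLp (tfShiftFun p g) 2 volume := by
  have h1 : MemLp (fun t => g (t - p.1)) 2 volume :=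
    hg.comp_measurePreserving (measurePreserving_sub_right volume p.1)
  have hc : Continuous fun t : ℝ => Complex.exp (2 * Real.pi * Complex.I * p.2 * t) := by fun_prop
  refine h1.of_le (hc.aestronglyMeasurable.mul h1.1) (Filter.Eventually.of_forall fun t => ?_)
  simp only [tfShiftFun, norm_mul, norm_chirp, one_mul, le_refl]

/-- The time-frequency shift `π(x, ω)` on `L²(ℝ)`. -/
noncomputable def tfShift (p : ℝ × ℝ) (g : L2) : L2 :=
  (memLp_tfShiftFun p (Lp.memLp g)).toLp (tfShiftFun p g)

/-- The short-time Fourier transform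
`V_g f (x, ω) = ∫ f(t) conj(g(t - x)) e^{-2π i ω t} dt`. The integrand is integrable for all
`f, g ∈ L²(ℝ)`. -/
noncomputable def stft (g f : L2) (p : ℝ × ℝ) : ℂ :=
  ∫ t : ℝ, f t * conj (g (t - p.1)) * Complex.exp (-(2 * Real.pi * Complex.I * p.2 * t))

/-- `V_g f (λ) = ⟨f, π(λ) g⟩`. Mathlib's inner product is conjugate-linear in its first slot, so
the inner product `⟨f, h⟩ = ∫ f conj(h)` is written `inner ℂ h f`. -/
theorem stft_eq_inner (g f : L2) (p : ℝ × ℝ) : stft g f p = inner ℂ (tfShift p g) f := by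
  rw [L2.inner_def, stft]
  refine integral_congr_ae ?_
  filter_upwards [(memLp_tfShiftFun p (Lp.memLp g)).coeFn_toLp] with t ht
  rw [tfShift, ht, RCLike.inner_apply, tfShiftFun, map_mul, ← Complex.exp_conj]
  have h : conj (2 * Real.pi * Complex.I * p.2 * t : ℂ)
      = -(2 * Real.pi * Complex.I * p.2 * t) := by
    simp [Complex.conj_ofReal, map_ofNat]
  rw [h]
  ring

/-- Feichtinger's algebra `S₀(ℝ)`: all `g ∈ L²(ℝ)` with `V_g g ∈ L¹(ℝ²)`. -/
def feichtingerAlgebra : Set L2 :=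
  {g | Integrable (stft g g) (volume : Measure (ℝ × ℝ))}

/-- An even element of `L²(ℝ)`: `g(-t) = g(t)`, as an identity of classes modulo almost everywhere
equality. -/
def IsEven (g : L2) : Prop :=
  ∀ᵐ t : ℝ, g (-t) = g t

/-- The lattice `S ℤ²` in the time-frequency plane `ℝ²`, where `S ∈ SL(2, ℝ)`; it has density `1`. -/
def lattice (S : Matrix.SpecialLinearGroup (Fin 2) ℝ) : Set (ℝ × ℝ) :=
  Set.range fun n : ℤ × ℤ =>
    ((S.1 0 0 * n.1 + S.1 0 1 * n.2 : ℝ), (S.1 1 0 * n.1 + S.1 1 1 * n.2 : ℝ))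

/-- The sum `∑_{λ ∈ Λ} |⟨f, π(λ) g⟩|²`, with values in `[0, ∞]`. -/
noncomputable def frameSum (g : L2) (Λ : Set (ℝ × ℝ)) (f : L2) : ℝ≥0∞ :=
  ∑' p : Λ, ‖(inner ℂ (tfShift p g) f : ℂ)‖ₑ ^ 2

/-- The Gabor system `G(g, Λ) = {π(λ) g : λ ∈ Λ}` is a frame for `L²(ℝ)`: there are constants
`0 < A ≤ B < ∞` with `A ‖f‖² ≤ ∑_{λ ∈ Λ} |⟨f, π(λ) g⟩|² ≤ B ‖f‖²` for all `f ∈ L²(ℝ)`. -/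
def IsGaborFrame (g : L2) (Λ : Set (ℝ × ℝ)) : Prop :=
  ∃ A B : ℝ≥0∞, 0 < A ∧ A ≤ B ∧ B < ∞ ∧
    ∀ f : L2, A * ‖f‖ₑ ^ 2 ≤ frameSum g Λ f ∧ frameSum g Λ f ≤ B * ‖f‖ₑ ^ 2

/-- The (sharp) lower frame bound of `G(g, Λ)`: the supremum of all `A ≥ 0` such that
`A ‖f‖² ≤ ∑_{λ ∈ Λ} |⟨f, π(λ) g⟩|²` for all `f ∈ L²(ℝ)`. -/
noncomputable def lowerFrameBound (g : L2) (Λ : Set (ℝ × ℝ)) : ℝ≥0∞ :=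
  sSup {A : ℝ≥0∞ | ∀ f : L2, A * ‖f‖ₑ ^ 2 ≤ frameSum g Λ f}

end Gabor

/-! Suppose the lower frame inequality holds with some `A > 0`. The symmetrized shifts `ρ(p) g` have
inner products `F (p - q)` up to a phase given by the symplectic form, where `F` is the ambiguity
function: integrable since `g ∈ S₀`, even since `g` is. The symplectic form is invariant under
`SL(2, ℝ)`, so composing `F` with `S` reduces the lattice to `ℤ²`. At density 1 the shifts by `ℤ²`
commute, and sign corrections turn the orbits of all points `z` into jointly stationary sequences.

Averaging over large boxes (`tsum_eq_zero_of_lower_bound`): if the total correlation of `x` with the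
frame vanishes, the frame inequality makes the squared norms of the box sums of `x` of lower order
than the box, and Cauchy–Schwarz then kills the total correlation of `x` with any other orbit. By
evenness the orbits of `z` and `-z` have equal total correlation with the frame, so their difference
can serve as `x`; this gives the reflection identity `twistedSum_reflect`. Using it for two
characters of `ℤ²` yields the same identity with opposite signs, hence `twistedSum_eq_zero`. Fourier
uniqueness gives `F = 0` almost everywhere, continuity at the origin gives `‖g‖² = F 0 = 0`, and the
zero window has no positive lower bound. -/

namespace Gabor

open Filter Topology

/-! ### Averaging over boxes of `ℤ²` -/

/-- The box `[0, N)²` in `ℤ²`. -/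
noncomputable def box (N : ℕ) : Finset (ℤ × ℤ) := Finset.Ico 0 (N : ℤ) ×ˢ Finset.Ico 0 (N : ℤ)

theorem card_box (N : ℕ) : (box N).card = N ^ 2 := by
  simp [box, sq]

/-- The indicator function of a finite set, with values in `ℂ`. -/
noncomputable def ind {G : Type*} [DecidableEq G] (Q : Finset G) (m : G) : ℂ :=
  if m ∈ Q then 1 else 0

theorem tsum_enorm_ind {G : Type*} [DecidableEq G] (Q : Finset G) :
    ∑' m, ‖ind Q m‖ₑ = Q.card := by
  rw [tsum_eq_sum (s := Q) fun m hm => by simp [ind, hm]]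
  rw [Finset.sum_congr rfl fun m hm => show ‖ind Q m‖ₑ = 1 by simp [ind, hm]]
  simp

theorem tsum_enorm_ind_add {G : Type*} [AddCommGroup G] [DecidableEq G] (Q : Finset G) (k : G) :
    ∑' m, ‖ind Q (m + k)‖ₑ = Q.card := by
  rw [← tsum_enorm_ind Q]
  exact (Equiv.addRight k).tsum_eq (fun m => ‖ind Q m‖ₑ)

/-- The size of the symmetric difference of `Q` and its translate by `-k`. -/
noncomputable def boundary {G : Type*} [AddCommGroup G] [DecidableEq G] (Q : Finset G) (k : G) :
    ℝ≥0∞ :=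
  ∑' m, ‖ind Q (m + k) - ind Q m‖ₑ

theorem boundary_le {G : Type*} [AddCommGroup G] [DecidableEq G] (Q : Finset G) (k : G) :
    boundary Q k ≤ 2 * Q.card := by
  calc boundary Q k ≤ ∑' m, (‖ind Q (m + k)‖ₑ + ‖ind Q m‖ₑ) :=
        ENNReal.tsum_le_tsum fun m => enorm_sub_le
    _ = 2 * Q.card := by
        rw [ENNReal.tsum_add, tsum_enorm_ind, tsum_enorm_ind_add, two_mul]

theorem boundary_le_card {G : Type*} [AddCommGroup G] [DecidableEq G] (Q : Finset G) (k : G) :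
    boundary Q k ≤ ((Q.filter fun m => m + k ∉ Q).card : ℝ≥0∞)
      + ((Q.filter fun m => m + -k ∉ Q).card : ℝ≥0∞) := by
  rw [← tsum_enorm_ind, ← tsum_enorm_ind_add (Q.filter fun m => m + -k ∉ Q) k, ← ENNReal.tsum_add]
  refine ENNReal.tsum_le_tsum fun m => ?_
  by_cases h1 : m ∈ Q <;> by_cases h2 : m + k ∈ Q <;> simp [ind, h1, h2]

theorem card_filter_box_le (N : ℕ) (k : ℤ × ℤ) :
    ((box N).filter fun m => m + k ∉ box N).card ≤ 2 * (k.1.natAbs + k.2.natAbs) * N := by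
  -- Strips at both ends of the interval, so that one set serves either sign of `j`.
  set I : ℤ → Finset ℤ := fun j => Finset.Ico 0 |j| ∪ Finset.Ico (N - |j|) N with hI
  have hcard (j : ℤ) : (I j).card ≤ 2 * j.natAbs := by
    refine (Finset.card_union_le _ _).trans ?_
    simp only [Int.card_Ico, sub_zero, sub_sub_cancel]
    have := abs_cases j
    omega
  have hsub : ((box N).filter fun m => m + k ∉ box N) ⊆
      (I k.1 ×ˢ Finset.Ico 0 (N : ℤ)) ∪ (Finset.Ico 0 (N : ℤ) ×ˢ I k.2) := by
    intro m
    simp only [box, hI, Finset.mem_filter, Finset.mem_product, Finset.mem_union, Finset.mem_Ico,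
      Prod.fst_add, Prod.snd_add]
    rcases abs_cases k.1 with h | h <;> rcases abs_cases k.2 with h' | h' <;> omega
  refine (Finset.card_le_card hsub).trans ((Finset.card_union_le _ _).trans ?_)
  rw [Finset.card_product, Finset.card_product]
  simp only [Int.card_Ico, sub_zero, Int.toNat_natCast]
  nlinarith [hcard k.1, hcard k.2]

theorem tendsto_boundary_box (k : ℤ × ℤ) :
    Tendsto (fun N : ℕ => boundary (box N) k / (box N).card) atTop (𝓝 0) := by
  set C : ℕ := 4 * (k.1.natAbs + k.2.natAbs) with hC
  have hlim : Tendsto (fun N : ℕ => (C : ℝ≥0∞) / N) atTop (𝓝 0) := by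
    simpa using ENNReal.Tendsto.const_div ENNReal.tendsto_nat_nhds_top
      (Or.inr (ENNReal.natCast_ne_top C))
  refine tendsto_of_tendsto_of_tendsto_of_le_of_le' tendsto_const_nhds hlim
    (Eventually.of_forall fun _ => zero_le) ?_
  filter_upwards [eventually_gt_atTop 0] with N hN
  have h : boundary (box N) k ≤ C * N := by
    refine (boundary_le_card _ k).trans ?_
    have h1 := card_filter_box_le N k
    have h2 := card_filter_box_le N (-k)
    simp only [Prod.fst_neg, Prod.snd_neg, Int.natAbs_neg] at h2
    have : ((box N).filter fun m => m + k ∉ box N).card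
        + ((box N).filter fun m => m + -k ∉ box N).card ≤ C * N := by
      rw [hC]; linarith
    exact_mod_cast this
  have hN0 : (N : ℝ≥0∞) ≠ 0 := by exact_mod_cast hN.ne'
  refine ENNReal.div_le_of_le_mul (h.trans (le_of_eq ?_))
  rw [card_box, Nat.cast_pow, sq, ← mul_assoc,
    ENNReal.div_mul_cancel hN0 (ENNReal.natCast_ne_top N)]

/-- Dominated convergence for the counting measure, with majorant `2 ‖a k‖` from `boundary_le`. -/
theorem tendsto_tsum_boundary_box {a : ℤ × ℤ → ℂ} (ha : Summable a) :
    Tendsto (fun N : ℕ => (∑' k, ‖a k‖ₑ * boundary (box N) k) / (box N).card) atTop (𝓝 0) := by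
  have hfin : ∑' k, ‖a k‖ₑ * 2 ≠ ∞ := by
    rw [ENNReal.tsum_mul_right]
    exact ENNReal.mul_ne_top (tsum_enorm_ne_top_iff_summable_norm.mpr ha.norm) (by simp)
  have key := tendsto_lintegral_of_dominated_convergence (μ := Measure.count)
    (F := fun (N : ℕ) k => ‖a k‖ₑ * (boundary (box N) k / (box N).card)) (f := fun _ => 0)
    (fun k => ‖a k‖ₑ * 2) (fun N => measurable_of_countable _)
    (fun N => Eventually.of_forall fun k => by
      refine mul_le_mul_right ?_ _
      exact ENNReal.div_le_of_le_mul (boundary_le _ k))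
    (by rwa [lintegral_count])
    (Eventually.of_forall fun k => by
      simpa using ENNReal.Tendsto.const_mul (tendsto_boundary_box k) (Or.inr enorm_ne_top))
  simp only [lintegral_count, tsum_zero] at key
  refine key.congr fun N => ?_
  simp only [div_eq_mul_inv, ← mul_assoc, ENNReal.tsum_mul_right]

/-! ### Box sums of a summable sequence -/

section Convolution

variable {G : Type*} [AddCommGroup G] [DecidableEq G] (Q : Finset G) {a : G → ℂ}

theorem hasSum_ind_mul (a : G → ℂ) (m : G) :
    HasSum (fun k => ind Q (m + k) * a k) (∑ n ∈ Q, a (n - m)) := by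
  have h : HasSum (fun n => ind Q n * a (n - m)) (∑ n ∈ Q, a (n - m)) := by
    have : HasSum (fun n => ind Q n * a (n - m)) (∑ n ∈ Q, ind Q n * a (n - m)) :=
      hasSum_sum_of_ne_finset_zero fun n hn => by simp [ind, hn]
    rwa [Finset.sum_congr rfl fun n hn => show ind Q n * a (n - m) = a (n - m) by simp [ind, hn]]
      at this
  have := (Equiv.addLeft m).hasSum_iff.mpr h
  simpa [Function.comp_def] using this

theorem enorm_sum_sub_le (ha : Summable a) (m : G) :
    ‖∑ n ∈ Q, a (n - m) - ind Q m * ∑' k, a k‖ₑ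
      ≤ ∑' k, ‖a k‖ₑ * ‖ind Q (m + k) - ind Q m‖ₑ := by
  have h := (hasSum_ind_mul Q a m).sub (ha.hasSum.mul_left (ind Q m))
  rw [← h.tsum_eq]
  refine (enorm_tsum_le_tsum_enorm).trans (ENNReal.tsum_le_tsum fun k => ?_)
  rw [← sub_mul, enorm_mul, mul_comm]

/-- Convolving the indicator of `Q` with `a` multiplies it by `∑ a`, up to pairs `m`, `m + k`
separated by the boundary of `Q`. -/
theorem tsum_enorm_sum_sub_le (ha : Summable a) :
    ∑' m, ‖∑ n ∈ Q, a (n - m) - ind Q m * ∑' k, a k‖ₑ ≤ ∑' k, ‖a k‖ₑ * boundary Q k := by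
  refine (ENNReal.tsum_le_tsum fun m => enorm_sum_sub_le Q ha m).trans (le_of_eq ?_)
  rw [ENNReal.tsum_comm]
  exact tsum_congr fun k => ENNReal.tsum_mul_left

theorem enorm_sum_le (m : G) : ‖∑ n ∈ Q, a (n - m)‖ₑ ≤ ∑' k, ‖a k‖ₑ * ‖ind Q (m + k)‖ₑ := by
  rw [← (hasSum_ind_mul Q a m).tsum_eq]
  refine (enorm_tsum_le_tsum_enorm).trans (ENNReal.tsum_le_tsum fun k => ?_)
  rw [enorm_mul, mul_comm]

theorem enorm_sum_le_tsum (m : G) : ‖∑ n ∈ Q, a (n - m)‖ₑ ≤ ∑' k, ‖a k‖ₑ := by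
  refine (enorm_sum_le Q m).trans (ENNReal.tsum_le_tsum fun k => ?_)
  by_cases h : m + k ∈ Q <;> simp [ind, h]

theorem tsum_enorm_sum_le : ∑' m, ‖∑ n ∈ Q, a (n - m)‖ₑ ≤ (∑' k, ‖a k‖ₑ) * Q.card := by
  refine (ENNReal.tsum_le_tsum fun m => enorm_sum_le Q m).trans (le_of_eq ?_)
  rw [ENNReal.tsum_comm, ← ENNReal.tsum_mul_right]
  exact tsum_congr fun k => by rw [ENNReal.tsum_mul_left, tsum_enorm_ind_add]

theorem tsum_enorm_sum_sq_le :
    ∑' m, ‖∑ n ∈ Q, a (n - m)‖ₑ ^ 2 ≤ (∑' k, ‖a k‖ₑ) * ∑' m, ‖∑ n ∈ Q, a (n - m)‖ₑ := by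
  rw [← ENNReal.tsum_mul_left]
  refine ENNReal.tsum_le_tsum fun m => ?_
  rw [sq]
  gcongr
  exact enorm_sum_le_tsum Q m

end Convolution

/-! ### Jointly stationary sequences -/

/-- If `c` satisfies a lower frame inequality and `x`, `y` are stationary with respect to `c` with
absolutely summable correlations, then a vanishing total correlation of `x` with `c` forces the total
correlation of `x` with `y` to vanish. -/
theorem tsum_eq_zero_of_lower_bound {H : Type*} [NormedAddCommGroup H] [InnerProductSpace ℂ H]
    {c x y : ℤ × ℤ → H} {a a' b : ℤ × ℤ → ℂ} (ha : Summable a) (ha' : Summable a')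
    (hb : Summable b) (hcx : ∀ m n, inner ℂ (c m) (x n) = a (n - m))
    (hcy : ∀ m n, inner ℂ (c m) (y n) = a' (n - m))
    (hyx : ∀ m n, inner ℂ (y m) (x n) = b (n - m)) (ha0 : ∑' k, a k = 0)
    {A : ℝ≥0∞} (hA0 : A ≠ 0) (hA : A ≠ ∞)
    (hlow : ∀ f : H, A * ‖f‖ₑ ^ 2 ≤ ∑' m, ‖(inner ℂ (c m) f : ℂ)‖ₑ ^ 2) :
    ∑' k, b k = 0 := by
  set X : ℕ → H := fun N => ∑ n ∈ box N, x n with hX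
  set Y : ℕ → H := fun N => ∑ n ∈ box N, y n with hY
  set α := ∑' k, ‖a k‖ₑ
  set α' := ∑' k, ‖a' k‖ₑ
  set β : ℕ → ℝ≥0∞ := fun N => (∑' k, ‖b k‖ₑ * boundary (box N) k) / (box N).card with hβ
  set δ : ℕ → ℝ≥0∞ := fun N => (∑' k, ‖a k‖ₑ * boundary (box N) k) / (box N).card with hδ
  -- The frame coefficients of `X N` are bounded by `α`, and since `∑ a = 0` their `ℓ¹` norm is only
  -- a boundary term; the product of the two bounds controls the `ℓ²` norm.
  have hXle (N : ℕ) : ‖X N‖ₑ ^ 2 / (box N).card ≤ A⁻¹ * α * δ N := by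
    have h1 : A * ‖X N‖ₑ ^ 2 ≤ α * ∑' k, ‖a k‖ₑ * boundary (box N) k := by
      refine (hlow _).trans ?_
      simp only [hX, inner_sum, hcx]
      refine (tsum_enorm_sum_sq_le _).trans ?_
      refine mul_le_mul_right ?_ _
      simpa [ha0] using tsum_enorm_sum_sub_le (box N) ha
    have h2 : ‖X N‖ₑ ^ 2 ≤ A⁻¹ * (α * ∑' k, ‖a k‖ₑ * boundary (box N) k) := by
      rw [← ENNReal.div_eq_inv_mul, ENNReal.le_div_iff_mul_le (Or.inl hA0) (Or.inl hA), mul_comm]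
      exact h1
    rw [hδ, ← mul_div_assoc, mul_assoc]
    gcongr
  -- Without cancellation the same argument gives growth of the order of the box, which suffices for
  -- `Y N`.
  have hYle (N : ℕ) : ‖Y N‖ₑ ^ 2 / (box N).card ≤ A⁻¹ * α' * α' := by
    have h1 : A * ‖Y N‖ₑ ^ 2 ≤ α' * (α' * (box N).card) := by
      refine (hlow _).trans ?_
      simp only [hY, inner_sum, hcy]
      refine (tsum_enorm_sum_sq_le _).trans ?_
      gcongr
      exact tsum_enorm_sum_le _
    refine ENNReal.div_le_of_le_mul ?_
    rw [mul_assoc, mul_assoc, ← ENNReal.div_eq_inv_mul,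
      ENNReal.le_div_iff_mul_le (Or.inl hA0) (Or.inl hA), mul_comm]
    exact h1
  have hmain (N : ℕ) (hN : 0 < N) :
      ‖∑' k, b k‖ₑ ≤ ((A⁻¹ * α * δ N) * (A⁻¹ * α' * α')) ^ (1 / 2 : ℝ) + β N := by
    have hc0 : ((box N).card : ℝ≥0∞) ≠ 0 := by
      rw [card_box]; exact_mod_cast (pow_pos hN 2).ne'
    have hct : ((box N).card : ℝ≥0∞) ≠ ∞ := ENNReal.natCast_ne_top _
    have h1 : ‖inner ℂ (Y N) (X N) - (box N).card * ∑' k, b k‖ₑ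
        ≤ ∑' k, ‖b k‖ₑ * boundary (box N) k := by
      have : inner ℂ (Y N) (X N) - (box N).card * ∑' k, b k
          = ∑ m ∈ box N, (∑ n ∈ box N, b (n - m) - ind (box N) m * ∑' k, b k) := by
        rw [Finset.sum_sub_distrib, ← Finset.sum_mul]
        congr 1
        · simp only [hX, hY, sum_inner]
          exact Finset.sum_congr rfl fun m _ => by simp only [inner_sum, hyx]
        · congr 1
          rw [Finset.sum_congr rfl fun m hm => show ind (box N) m = 1 by simp [ind, hm]]
          simp
      rw [this]
      refine (_root_.enorm_sum_le _ _).trans ((ENNReal.sum_le_tsum _).trans ?_)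
      exact tsum_enorm_sum_sub_le (box N) hb
    have h2 : (box N).card * ‖∑' k, b k‖ₑ
        ≤ ‖X N‖ₑ * ‖Y N‖ₑ + ∑' k, ‖b k‖ₑ * boundary (box N) k := by
      have e1 : ((box N).card : ℝ≥0∞) * ‖∑' k, b k‖ₑ = ‖((box N).card : ℂ) * ∑' k, b k‖ₑ := by
        rw [enorm_mul]; congr 1; simp [enorm_eq_nnnorm]
      have e2 : ‖(inner ℂ (Y N) (X N) : ℂ)‖ₑ ≤ ‖X N‖ₑ * ‖Y N‖ₑ := by
        simp only [enorm_eq_nnnorm]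
        rw [mul_comm]
        exact_mod_cast nnnorm_inner_le_nnnorm (𝕜 := ℂ) (Y N) (X N)
      rw [e1]
      calc ‖((box N).card : ℂ) * ∑' k, b k‖ₑ
          = ‖inner ℂ (Y N) (X N) - (inner ℂ (Y N) (X N) - (box N).card * ∑' k, b k)‖ₑ := by
            rw [sub_sub_cancel]
        _ ≤ _ := enorm_sub_le.trans (add_le_add e2 h1)
    have h3 : ‖∑' k, b k‖ₑ ≤ ‖X N‖ₑ * ‖Y N‖ₑ / (box N).card + β N := by
      rw [hβ, ← ENNReal.add_div, ENNReal.le_div_iff_mul_le (Or.inl hc0) (Or.inl hct), mul_comm]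
      exact h2
    refine h3.trans (add_le_add ?_ le_rfl)
    have h4 : (‖X N‖ₑ * ‖Y N‖ₑ / (box N).card) ^ 2 ≤ (A⁻¹ * α * δ N) * (A⁻¹ * α' * α') := by
      refine le_trans (le_of_eq ?_) (mul_le_mul' (hXle N) (hYle N))
      simp only [div_eq_mul_inv]
      ring
    rw [one_div, ENNReal.le_rpow_inv_iff (by norm_num)]
    exact_mod_cast h4
  have hlim : Tendsto (fun N => ((A⁻¹ * α * δ N) * (A⁻¹ * α' * α')) ^ (1 / 2 : ℝ) + β N)
      atTop (𝓝 0) := by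
    have hAi : A⁻¹ ≠ ∞ := ENNReal.inv_ne_top.mpr hA0
    have t1 : Tendsto (fun N => A⁻¹ * α * δ N) atTop (𝓝 0) := by
      simpa using ENNReal.Tendsto.const_mul (tendsto_tsum_boundary_box ha)
        (Or.inr (ENNReal.mul_ne_top hAi (tsum_enorm_ne_top_iff_summable_norm.mpr ha.norm)))
    have t2 : Tendsto (fun N => (A⁻¹ * α * δ N) * (A⁻¹ * α' * α')) atTop (𝓝 0) := by
      simpa using ENNReal.Tendsto.mul_const t1
        (Or.inr (ENNReal.mul_ne_top
          (ENNReal.mul_ne_top hAi (tsum_enorm_ne_top_iff_summable_norm.mpr ha'.norm))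
          (tsum_enorm_ne_top_iff_summable_norm.mpr ha'.norm)))
    have t3 := ((ENNReal.continuous_rpow_const (y := (1 / 2 : ℝ))).tendsto 0).comp t2
    rw [ENNReal.zero_rpow_of_pos (by norm_num)] at t3
    simpa using t3.add (tendsto_tsum_boundary_box hb)
  have h0 : ‖∑' k, b k‖ₑ ≤ 0 := by
    refine ge_of_tendsto hlim ?_
    filter_upwards [eventually_gt_atTop 0] with N hN using hmain N hN
  simpa using h0

/-! ### Phases and the symplectic form -/

/-- The character `t ↦ e^{π i t}`. -/
noncomputable def phase (t : ℝ) : ℂ := Complex.exp (Real.pi * t * Complex.I)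

theorem phase_add (s t : ℝ) : phase (s + t) = phase s * phase t := by
  rw [phase, phase, phase, ← Complex.exp_add]; congr 1; push_cast; ring

@[simp] theorem phase_zero : phase 0 = 1 := by simp [phase]

theorem norm_phase (t : ℝ) : ‖phase t‖ = 1 := by
  rw [phase, ← Complex.ofReal_mul, Complex.norm_exp_ofReal_mul_I]

theorem phase_ne_zero (t : ℝ) : phase t ≠ 0 := Complex.exp_ne_zero _

theorem conj_phase (t : ℝ) : conj (phase t) = phase (-t) := by
  rw [phase, phase, ← Complex.exp_conj]; simp [Complex.conj_ofReal]

@[fun_prop] theorem continuous_phase : Continuous phase := by unfold phase; fun_prop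

theorem phase_two_mul_int (n : ℤ) : phase (2 * n) = 1 := by
  rw [phase, Complex.exp_eq_one_iff]; exact ⟨n, by push_cast; ring⟩

theorem phase_eq_of_sub {s t : ℝ} (n : ℤ) (h : s - t = 2 * n) : phase s = phase t := by
  rw [← sub_add_cancel s t, h, phase_add, phase_two_mul_int, one_mul]

theorem phase_one : phase 1 = -1 := by simp [phase, Complex.exp_pi_mul_I]

/-- The standard symplectic form on `ℝ²`. -/
def symp (p q : ℝ × ℝ) : ℝ := p.1 * q.2 - p.2 * q.1

/-- The inclusion `ℤ² → ℝ²`. -/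
def toPlane (n : ℤ × ℤ) : ℝ × ℝ := (n.1, n.2)

theorem toPlane_sub (m n : ℤ × ℤ) : toPlane (m - n) = toPlane m - toPlane n := by
  simp [toPlane]

theorem toPlane_neg (n : ℤ × ℤ) : toPlane (-n) = -toPlane n := by simp [toPlane]

/-- The points `w` over whose integer translates `F` is absolutely summable. -/
def SummableAt (F : ℝ × ℝ → ℂ) (w : ℝ × ℝ) : Prop := Summable fun k => F (toPlane k + w)

/-- The twisted periodization of `F`. -/
noncomputable def twistedSum (F : ℝ × ℝ → ℂ) (ζ w : ℝ × ℝ) : ℂ :=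
  ∑' k : ℤ × ℤ, phase (k.1 * k.2 - symp (toPlane k) ζ) * F (toPlane k + w)

theorem SummableAt.phase_mul {F : ℝ × ℝ → ℂ} {w : ℝ × ℝ} (h : SummableAt F w)
    (u : ℤ × ℤ → ℝ) : Summable fun k => phase (u k) * F (toPlane k + w) :=
  Summable.of_norm (by simpa [norm_phase] using h.norm)

theorem SummableAt.neg {F : ℝ × ℝ → ℂ} (hF : ∀ p, F (-p) = F p) {w : ℝ × ℝ}
    (h : SummableAt F w) : SummableAt F (-w) := by
  refine ((Equiv.neg (ℤ × ℤ)).summable_iff.mpr h).congr fun k => ?_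
  rw [Function.comp_apply, Equiv.neg_apply, toPlane_neg, ← hF]
  congr 1
  abel

/-- Replacing `k` by `k - (1, 1)` changes `k.1 * k.2` by `1 - k.1 - k.2`. The `1` produces the minus
sign on which the proof rests; the rest is absorbed, modulo 2, by shifting `ζ`. -/
theorem twistedSum_add_one (F : ℝ × ℝ → ℂ) (ζ w : ℝ × ℝ) :
    twistedSum F ζ (w + (1, 1)) = -phase (symp (1, 1) ζ) * twistedSum F (ζ - (1, 1)) w := by
  rw [twistedSum, twistedSum, ← tsum_mul_left, ← (Equiv.subRight ((1, 1) : ℤ × ℤ)).tsum_eq]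
  refine tsum_congr fun k => ?_
  have h1 : toPlane (k - (1, 1)) + (w + (1, 1)) = toPlane k + w := by
    rw [toPlane_sub]; simp only [toPlane, Int.cast_one]; abel
  simp only [Equiv.subRight_apply, h1]
  rw [← mul_assoc, neg_mul, ← phase_add]
  congr 1
  rw [← neg_one_mul, ← phase_one, ← phase_add]
  refine phase_eq_of_sub (-k.1) ?_
  simp only [symp, toPlane, Prod.fst_sub, Prod.snd_sub]
  push_cast
  ring

/-! ### Twisted orbits and the reflection identity -/

section Stationary

variable {H : Type*} [NormedAddCommGroup H] [InnerProductSpace ℂ H] {v : ℝ × ℝ → H}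
  {F : ℝ × ℝ → ℂ}

/-- The orbit of `v z` under a commuting twisted action of `ℤ²`. -/
noncomputable def orbit (v : ℝ × ℝ → H) (κ : ℤ × ℤ) (z : ℝ × ℝ) (n : ℤ × ℤ) : H :=
  phase (n.1 * n.2 + symp (toPlane n) (toPlane κ - z)) • v (toPlane n + z)

/-- The symplectic form is an integer on `ℤ²`, so its phase there is a sign, which the factor
`(-1)^(n.1 * n.2)` trivializes; the correlations then depend on `n - m` alone. The parameter `κ`
twists the action by a sign character. -/
theorem inner_orbit (hv : ∀ p q, inner ℂ (v q) (v p) = phase (symp q p) * F (p - q))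
    (κ : ℤ × ℤ) (z z' : ℝ × ℝ) (m n : ℤ × ℤ) :
    inner ℂ (orbit v κ z' m) (orbit v κ z n)
      = phase (symp z' z) * (phase ((n - m).1 * (n - m).2
          - symp (toPlane (n - m)) (z + z' - toPlane κ)) * F (toPlane (n - m) + (z - z'))) := by
  have h1 : toPlane n + z - (toPlane m + z') = toPlane (n - m) + (z - z') := by
    rw [toPlane_sub]; abel
  rw [orbit, orbit, inner_smul_left, inner_smul_right, hv, h1, conj_phase, ← mul_assoc,
    ← mul_assoc, ← mul_assoc, ← phase_add, ← phase_add, ← phase_add]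
  congr 1
  refine phase_eq_of_sub (m.1 * n.2 - m.1 * m.2) ?_
  simp only [symp, toPlane, Prod.fst_sub, Prod.snd_sub, Prod.fst_add, Prod.snd_add]
  push_cast
  ring

theorem twistedSum_reflect (hv : ∀ p q, inner ℂ (v q) (v p) = phase (symp q p) * F (p - q))
    (hF : ∀ p, F (-p) = F p) {A : ℝ≥0∞} (hA0 : A ≠ 0) (hA : A ≠ ∞)
    (hlow : ∀ f : H, A * ‖f‖ₑ ^ 2 ≤ ∑' n, ‖(inner ℂ (v (toPlane n)) f : ℂ)‖ₑ ^ 2)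
    (κ : ℤ × ℤ) {z z' : ℝ × ℝ} (hz : SummableAt F z) (hz' : SummableAt F z')
    (hsub : SummableAt F (z - z')) (hadd : SummableAt F (z + z')) :
    phase (symp z' z) * twistedSum F (z + z' - toPlane κ) (z - z')
      = phase (-symp z' z) * twistedSum F (-z + z' - toPlane κ) (-z - z') := by
  set a : ℝ × ℝ → ℤ × ℤ → ℂ := fun p k =>
    phase (k.1 * k.2 - symp (toPlane k) (p - toPlane κ)) * F (toPlane k + p) with ha
  have hsa {p : ℝ × ℝ} (hp : SummableAt F p) : Summable (a p) := hp.phase_mul _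
  have hca (p : ℝ × ℝ) (m n : ℤ × ℤ) :
      inner ℂ (orbit v κ 0 m) (orbit v κ p n) = a p (n - m) := by
    rw [inner_orbit hv]
    simp [symp, ha]
  -- Substitute `k ↦ -k` and use that `F` is even. The character attached to `κ` takes values `±1`,
  -- so it is unaffected by the reflection.
  have hsymm : ∑' k, a z k = ∑' k, a (-z) k := by
    rw [← (Equiv.neg (ℤ × ℤ)).tsum_eq]
    refine tsum_congr fun k => ?_
    simp only [ha, Equiv.neg_apply]
    rw [← hF, show -(toPlane (-k) + z) = toPlane k + -z by rw [toPlane_neg]; abel]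
    congr 1
    refine phase_eq_of_sub (-(k.1 * κ.2 - k.2 * κ.1)) ?_
    simp only [symp, toPlane, Prod.fst_sub, Prod.snd_sub, Prod.fst_neg, Prod.snd_neg]
    push_cast
    ring
  set b : ℝ × ℝ → ℤ × ℤ → ℂ := fun p k => phase (symp z' p) *
    (phase (k.1 * k.2 - symp (toPlane k) (p + z' - toPlane κ)) * F (toPlane k + (p - z'))) with hb
  have hsb {p : ℝ × ℝ} (hp : SummableAt F (p - z')) : Summable (b p) :=
    (hp.phase_mul _).mul_left _
  have hneg : SummableAt F (-z - z') := by
    rw [← neg_add']; exact hadd.neg hF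
  have key := tsum_eq_zero_of_lower_bound (c := orbit v κ 0)
    (x := fun n => orbit v κ z n - orbit v κ (-z) n) (y := orbit v κ z')
    (a := fun k => a z k - a (-z) k) (a' := a z') (b := fun k => b z k - b (-z) k)
    ((hsa hz).sub (hsa (hz.neg hF))) (hsa hz') ((hsb hsub).sub (hsb hneg))
    (fun m n => by rw [inner_sub_right, hca, hca]) (fun m n => hca z' m n)
    (fun m n => by rw [inner_sub_right, inner_orbit hv, inner_orbit hv])
    (by rw [(hsa hz).tsum_sub (hsa (hz.neg hF)), hsymm, sub_self]) hA0 hA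
    -- The orbit of `0` consists of the integer points `v (toPlane n)` up to unimodular factors, so
    -- it inherits the lower inequality.
    (fun f => by
      refine (hlow f).trans (le_of_eq (tsum_congr fun n => ?_))
      rw [orbit, inner_smul_left, enorm_mul, conj_phase, ← ofReal_norm (phase _),
        norm_phase, ENNReal.ofReal_one, one_mul, add_zero])
  rw [(hsb hsub).tsum_sub (hsb hneg), sub_eq_zero] at key
  simp only [hb, tsum_mul_left] at key
  have hs : symp z' (-z) = -symp z' z := by simp [symp]; ring
  rwa [hs] at key

/-- The reflection identity is used with `κ = 0` at the half sum and half difference of `ζ` and `w`,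
and with `κ = (1, 1)` after moving both points by `(1/2, 1/2)`. The left sides both involve
`twistedSum F ζ w`; by `twistedSum_add_one` the right sides differ by a sign. -/
theorem twistedSum_eq_zero (hv : ∀ p q, inner ℂ (v q) (v p) = phase (symp q p) * F (p - q))
    (hF : ∀ p, F (-p) = F p) {A : ℝ≥0∞} (hA0 : A ≠ 0) (hA : A ≠ ∞)
    (hlow : ∀ f : H, A * ‖f‖ₑ ^ 2 ≤ ∑' n, ‖(inner ℂ (v (toPlane n)) f : ℂ)‖ₑ ^ 2)
    {ζ w : ℝ × ℝ} (hw : SummableAt F w) (hζ : SummableAt F ζ)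
    (h1 : SummableAt F ((1 / 2 : ℝ) • (ζ + w)))
    (h2 : SummableAt F ((1 / 2 : ℝ) • (ζ - w)))
    (hζ' : SummableAt F (ζ + (1, 1)))
    (h1' : SummableAt F ((1 / 2 : ℝ) • (ζ + w) + (1 / 2, 1 / 2)))
    (h2' : SummableAt F ((1 / 2 : ℝ) • (ζ - w) + (1 / 2, 1 / 2))) :
    twistedSum F ζ w = 0 := by
  set y := (1 / 2 : ℝ) • (ζ + w) with hy
  set y' := (1 / 2 : ℝ) • (ζ - w) with hy'
  have e1 : y - y' = w := by ext <;> simp [hy, hy'] <;> ring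
  have e2 : y + y' = ζ := by ext <;> simp [hy, hy'] <;> ring
  have r0 := twistedSum_reflect hv hF hA0 hA hlow 0 h1 h2 (by rwa [e1]) (by rwa [e2])
  have e3 : y + (1 / 2, 1 / 2) - (y' + (1 / 2, 1 / 2)) = w := by rw [← e1]; abel
  have e4 : y + (1 / 2, 1 / 2) + (y' + (1 / 2, 1 / 2)) = ζ + (1, 1) := by
    rw [← e2]; ext <;> simp <;> ring
  have r1 := twistedSum_reflect hv hF hA0 hA hlow (1, 1) h1' h2' (by rwa [e3]) (by rwa [e4])
  have t0 : toPlane 0 = 0 := by simp [toPlane]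
  have t1 : toPlane (1, 1) = (1, 1) := by simp [toPlane]
  have e5 : -(y + (1 / 2, 1 / 2)) + (y' + (1 / 2, 1 / 2)) - (1, 1) = -w - (1, 1) := by
    rw [← e3]; abel
  have e6 : -(y + (1 / 2, 1 / 2)) - (y' + (1 / 2, 1 / 2)) = -ζ - (1, 1) := by
    rw [← neg_add', e4, neg_add']
  rw [e3, e4, t1, e5, e6, add_sub_cancel_right] at r1
  rw [e1, e2, t0, sub_zero, sub_zero, ← neg_add', e2,
    show -y + y' = -w by rw [← e1]; abel,
    show -ζ = -ζ - (1, 1) + (1, 1) by abel, twistedSum_add_one] at r0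
  set T := twistedSum F (-w - (1, 1)) (-ζ - (1, 1))
  set u := symp y' y
  have hs : symp (y' + (1 / 2, 1 / 2)) (y + (1 / 2, 1 / 2)) = u - symp (1, 1) (-w) / 2 := by
    rw [← e1]; simp [u, symp]; ring
  rw [hs] at r1
  set σ := symp (1, 1) (-w)
  have q0 : twistedSum F ζ w = - (phase (σ - 2 * u) * T) := by
    have := congrArg (phase (-u) * ·) r0
    simp only [← mul_assoc, ← phase_add, neg_add_cancel, phase_zero, one_mul] at this
    rw [this, mul_neg, neg_mul, ← phase_add]
    congr 3; ring
  have q1 : twistedSum F ζ w = phase (σ - 2 * u) * T := by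
    have := congrArg (phase (-(u - σ / 2)) * ·) r1
    simp only [← mul_assoc, ← phase_add, neg_add_cancel, phase_zero, one_mul] at this
    rw [this]
    congr 2; ring
  rw [← q1] at q0
  exact self_eq_neg.mp q0

end Stationary

/-! ### Summability along the lattice and Fourier uniqueness -/

/-- The integral of `∑ ‖F (n + w)‖` over a unit cell equals `∫ ‖F‖`, hence is finite; countably many
cells cover the plane. -/
theorem ae_summableAt {F : ℝ × ℝ → ℂ} (hF : Integrable F) : ∀ᵐ w, SummableAt F w := by
  set C : ℤ × ℤ → Set (ℝ × ℝ) := fun n =>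
    Set.Ico (n.1 : ℝ) (n.1 + 1) ×ˢ Set.Ico (n.2 : ℝ) (n.2 + 1) with hC
  have hCm (n : ℤ × ℤ) : MeasurableSet (C n) := measurableSet_Ico.prod measurableSet_Ico
  have hmem (n : ℤ × ℤ) (p : ℝ × ℝ) : p ∈ C n ↔ (⌊p.1⌋, ⌊p.2⌋) = n := by
    simp only [hC, Set.mem_prod, Set.mem_Ico, Prod.ext_iff, Int.floor_eq_iff]
  have hdisj : Pairwise (Function.onFun Disjoint C) := fun m n hmn =>
    Set.disjoint_left.mpr fun p hm hn => hmn (((hmem m p).mp hm).symm.trans ((hmem n p).mp hn))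
  have hcover : ⋃ n, C n = Set.univ :=
    Set.eq_univ_of_forall fun p => Set.mem_iUnion.mpr ⟨_, (hmem _ p).mpr rfl⟩
  have hshift (m n : ℤ × ℤ) : ∫⁻ w in C m, ‖F (toPlane n + w)‖ₑ = ∫⁻ w in C (n + m), ‖F w‖ₑ := by
    have hpre : (fun w => toPlane n + w) ⁻¹' C (n + m) = C m := by
      ext w
      simp only [hC, toPlane, Set.mem_preimage, Set.mem_prod, Set.mem_Ico, Prod.fst_add,
        Prod.snd_add, Int.cast_add]
      constructor <;> rintro ⟨⟨_, _⟩, _, _⟩ <;> refine ⟨⟨?_, ?_⟩, ?_, ?_⟩ <;> linarith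
    rw [← hpre]
    exact (measurePreserving_add_left volume (toPlane n)).setLIntegral_comp_preimage_emb
      (measurableEmbedding_addLeft _) (fun w => ‖F w‖ₑ) _
  have hcell (m : ℤ × ℤ) : ∀ᵐ w ∂volume.restrict (C m), SummableAt F w := by
    have hmeas (n : ℤ × ℤ) :
        AEMeasurable (fun w => ‖F (toPlane n + w)‖ₑ) (volume.restrict (C m)) :=
      ((hF.1.comp_measurePreserving (measurePreserving_add_left volume (toPlane n))).enorm).restrict
    have hfin : ∫⁻ w in C m, ∑' n, ‖F (toPlane n + w)‖ₑ ≠ ∞ := by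
      rw [lintegral_tsum hmeas, tsum_congr (hshift m),
        show ∑' n, ∫⁻ w in C (n + m), ‖F w‖ₑ = ∑' n, ∫⁻ w in C n, ‖F w‖ₑ from
          (Equiv.addRight m).tsum_eq (fun n => ∫⁻ w in C n, ‖F w‖ₑ),
        ← lintegral_iUnion hCm hdisj, hcover, setLIntegral_univ]
      exact hF.2.ne
    filter_upwards [ae_lt_top' (AEMeasurable.tsum hmeas) hfin] with w hw
    exact Summable.of_enorm hw.ne
  rw [← Measure.restrict_univ (μ := (volume : Measure (ℝ × ℝ))), ← hcover, ae_restrict_iUnion_iff]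
  exact hcell

theorem integral_phase {n : ℤ} (hn : n ≠ 0) (c : ℝ) : ∫ t in (0 : ℝ)..2, phase (c + n * t) = 0 := by
  have h : (Real.pi * n * Complex.I : ℂ) ≠ 0 := by
    simp [Real.pi_ne_zero, hn]
  have e (t : ℝ) : phase (c + n * t) = phase c * Complex.exp (Real.pi * n * Complex.I * t) := by
    rw [phase_add, phase, phase]; congr 2; push_cast; ring
  simp_rw [e]
  rw [intervalIntegral.integral_const_mul, integral_exp_mul_complex h]
  have : Complex.exp (Real.pi * n * Complex.I * (2 : ℝ)) = 1 :=
    Complex.exp_eq_one_iff.mpr ⟨n, by push_cast; ring⟩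
  rw [this]
  simp

/-- Orthogonality of characters; the square has side 2 because `phase` has period 2. -/
theorem integral_phase_symp {k : ℤ × ℤ} (hk : k ≠ 0) (c : ℝ) :
    ∫ ζ in Set.Ioc (0 : ℝ) 2 ×ˢ Set.Ioc (0 : ℝ) 2, phase (c - symp (toPlane k) ζ) = 0 := by
  have hint : IntegrableOn (fun ζ => phase (c - symp (toPlane k) ζ))
      (Set.Ioc (0 : ℝ) 2 ×ˢ Set.Ioc (0 : ℝ) 2) (volume.prod volume) := by
    have hcont : Continuous fun ζ : ℝ × ℝ => phase (c - symp (toPlane k) ζ) := by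
      unfold symp; fun_prop
    exact (hcont.continuousOn.integrableOn_compact (isCompact_Icc.prod isCompact_Icc)).mono_set
      (Set.prod_mono Set.Ioc_subset_Icc_self Set.Ioc_subset_Icc_self)
  rw [Measure.volume_eq_prod]
  rw [setIntegral_prod _ hint]
  by_cases h1 : k.1 = 0
  · have h2 : k.2 ≠ 0 := fun h2 => hk (Prod.ext h1 h2)
    have := integral_phase h2 c
    rw [intervalIntegral.integral_of_le zero_le_two] at this
    simp [symp, toPlane, h1, integral_const_mul, this]
  · refine integral_eq_zero_of_ae (Eventually.of_forall fun x => ?_)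
    have := integral_phase (neg_ne_zero.mpr h1) (c + k.2 * x)
    rw [intervalIntegral.integral_of_le zero_le_two] at this
    rw [Pi.zero_apply, ← this]
    simp only [symp, toPlane]
    refine integral_congr_ae (Eventually.of_forall fun y => ?_)
    simp only
    congr 1
    push_cast
    ring

/-- As a function of `ζ`, the twisted sum is an absolutely convergent Fourier series whose constant
term is `F w`. -/
theorem eq_zero_of_ae_twistedSum_eq_zero {F : ℝ × ℝ → ℂ} {w : ℝ × ℝ} (hw : SummableAt F w)
    (h : ∀ᵐ ζ, twistedSum F ζ w = 0) : F w = 0 := by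
  set D := Set.Ioc (0 : ℝ) 2 ×ˢ Set.Ioc (0 : ℝ) 2 with hD
  have hvol : volume D = 4 := by
    rw [hD, Measure.volume_eq_prod, Measure.prod_prod]
    simp only [Real.volume_Ioc, sub_zero, ENNReal.ofReal_ofNat]
    norm_num
  have : IsFiniteMeasure (volume.restrict D) := ⟨by simp [hvol]⟩
  have hcont (k : ℤ × ℤ) : Continuous fun ζ =>
      phase (k.1 * k.2 - symp (toPlane k) ζ) * F (toPlane k + w) := by
    unfold symp; fun_prop
  have hint (k : ℤ × ℤ) : Integrable (fun ζ =>
      phase (k.1 * k.2 - symp (toPlane k) ζ) * F (toPlane k + w)) (volume.restrict D) :=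
    Integrable.of_bound (hcont k).aestronglyMeasurable ‖F (toPlane k + w)‖
      (Eventually.of_forall fun ζ => by rw [norm_mul, norm_phase, one_mul])
  have hsum := hasSum_integral_of_summable_integral_norm hint (by
    simp only [norm_mul, norm_phase, one_mul, integral_const]
    exact hw.norm.mul_left _)
  have h0 : ∫ ζ in D, ∑' k : ℤ × ℤ, phase (k.1 * k.2 - symp (toPlane k) ζ) * F (toPlane k + w)
      = 0 :=
    integral_eq_zero_of_ae (ae_restrict_of_ae h)
  rw [h0] at hsum
  have h1 := hsum.unique (hasSum_single 0 fun k hk => by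
    rw [integral_mul_const, integral_phase_symp hk, zero_mul])
  have h2 : toPlane 0 = 0 := by simp [toPlane]
  simpa [h2, symp, Measure.real, hvol] using h1.symm

theorem ae_comp_half_smul_add {p : ℝ × ℝ → Prop} (hp : ∀ᵐ w, p w) (c : ℝ × ℝ) :
    ∀ᵐ ζ : ℝ × ℝ, p ((1 / 2 : ℝ) • ζ + c) :=
  ((measurePreserving_add_right volume c).quasiMeasurePreserving.comp
    (Measure.quasiMeasurePreserving_smul volume (by norm_num))).ae hp

/-- A family with even, integrable, twisted-stationary correlation function `F` whose integer points
satisfy a lower frame inequality has `F = 0` almost everywhere. -/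
theorem ae_eq_zero_of_lower_bound {H : Type*} [NormedAddCommGroup H] [InnerProductSpace ℂ H]
    {v : ℝ × ℝ → H} {F : ℝ × ℝ → ℂ}
    (hv : ∀ p q, inner ℂ (v q) (v p) = phase (symp q p) * F (p - q))
    (hF : ∀ p, F (-p) = F p) (hint : Integrable F) {A : ℝ≥0∞} (hA0 : A ≠ 0) (hA : A ≠ ∞)
    (hlow : ∀ f : H, A * ‖f‖ₑ ^ 2 ≤ ∑' n, ‖(inner ℂ (v (toPlane n)) f : ℂ)‖ₑ ^ 2) :
    ∀ᵐ w, F w = 0 := by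
  have hs := ae_summableAt hint
  filter_upwards [hs] with w hw
  refine eq_zero_of_ae_twistedSum_eq_zero hw ?_
  filter_upwards [hs, ae_comp_half_smul_add hs ((1 / 2 : ℝ) • w),
    ae_comp_half_smul_add hs (-((1 / 2 : ℝ) • w)),
    (measurePreserving_add_right volume ((1, 1) : ℝ × ℝ)).quasiMeasurePreserving.ae hs,
    ae_comp_half_smul_add hs ((1 / 2 : ℝ) • w + (1 / 2, 1 / 2)),
    ae_comp_half_smul_add hs (-((1 / 2 : ℝ) • w) + (1 / 2, 1 / 2))] with ζ h0 h1 h2 h3 h4 h5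
  refine twistedSum_eq_zero hv hF hA0 hA hlow hw h0 ?_ ?_ h3 ?_ ?_
  · rwa [smul_add]
  · rwa [smul_sub, sub_eq_add_neg]
  · rwa [smul_add, add_assoc]
  · rwa [smul_sub, sub_eq_add_neg, add_assoc]

/-! ### Symmetrized time-frequency shifts -/

theorem coeFn_tfShift (p : ℝ × ℝ) (g : L2) : tfShift p g =ᵐ[volume] tfShiftFun p g :=
  (memLp_tfShiftFun p (Lp.memLp g)).coeFn_toLp

theorem tfShift_zero (g : L2) : tfShift 0 g = g := by
  refine Lp.ext ((coeFn_tfShift 0 g).trans (Eventually.of_forall fun t => ?_))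
  simp [tfShiftFun]

/-- The symmetrized time-frequency shift `ρ(x, ω) g = e^{-π i x ω} π(x, ω) g`. -/
noncomputable def symShift (p : ℝ × ℝ) (g : L2) : L2 := phase (-(p.1 * p.2)) • tfShift p g

/-- The ambiguity function `⟨ρ(p) g, g⟩`. -/
noncomputable def ambiguity (g : L2) (p : ℝ × ℝ) : ℂ := inner ℂ g (symShift p g)

theorem ambiguity_eq (g : L2) (p : ℝ × ℝ) :
    ambiguity g p = phase (-(p.1 * p.2)) * inner ℂ g (tfShift p g) := by
  rw [ambiguity, symShift, inner_smul_right]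

theorem inner_tfShift_right (f g : L2) (p : ℝ × ℝ) :
    (inner ℂ f (tfShift p g) : ℂ) = ∫ t, tfShiftFun p g t * conj (f t) := by
  rw [L2.inner_def]
  refine integral_congr_ae ?_
  filter_upwards [coeFn_tfShift p g] with t ht
  rw [RCLike.inner_apply, ht]

theorem inner_symShift (g : L2) (p q : ℝ × ℝ) :
    inner ℂ (symShift q g) (symShift p g) = phase (symp q p) * ambiguity g (p - q) := by
  have key : (inner ℂ (tfShift q g) (tfShift p g) : ℂ)
      = phase (2 * (p.2 - q.2) * q.1) * inner ℂ g (tfShift (p - q) g) := by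
    rw [inner_tfShift_right, inner_tfShift_right, ← integral_const_mul,
      ← integral_add_right_eq_self _ q.1]
    refine integral_congr_ae ?_
    filter_upwards [(measurePreserving_add_right volume q.1).quasiMeasurePreserving.ae
      (coeFn_tfShift q g)] with t ht
    rw [ht]
    simp only [tfShiftFun, map_mul, phase, ← Complex.exp_conj, Prod.fst_sub, Prod.snd_sub,
      Complex.conj_ofReal, Complex.conj_I, map_ofNat, add_sub_cancel_right]
    rw [show t + q.1 - p.1 = t - (p.1 - q.1) by ring]
    have he (a b c d : ℂ) (x y : ℂ) (h : a + b = c + d) :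
        Complex.exp a * x * (Complex.exp b * y) = Complex.exp c * (Complex.exp d * x * y) := by
      calc _ = Complex.exp (a + b) * x * y := by rw [Complex.exp_add]; ring
        _ = _ := by rw [h, Complex.exp_add]; ring
    refine he _ _ _ _ _ _ ?_
    push_cast
    ring
  rw [symShift, symShift, inner_smul_left, inner_smul_right, key, conj_phase, ambiguity_eq,
    ← mul_assoc, ← mul_assoc, ← mul_assoc, ← phase_add, ← phase_add, ← phase_add]
  congr 2
  simp only [symp, Prod.fst_sub, Prod.snd_sub]
  ring

/-- The substitution `t ↦ -t` turns the shift by `-p` of an even function into the shift by `p`, and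
the symmetrizing phase depends only on `p.1 * p.2`. -/
theorem ambiguity_neg {g : L2} (hg : IsEven g) (p : ℝ × ℝ) :
    ambiguity g (-p) = ambiguity g p := by
  rw [ambiguity_eq, ambiguity_eq, inner_tfShift_right, inner_tfShift_right,
    ← integral_neg_eq_self]
  congr 1
  · simp
  refine integral_congr_ae ?_
  filter_upwards [hg, (measurePreserving_sub_right volume p.1).quasiMeasurePreserving.ae hg]
    with t h1 h2
  simp only [tfShiftFun, Prod.fst_neg, Prod.snd_neg, h1]
  rw [show -t - -p.1 = -(t - p.1) by ring, h2]
  push_cast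
  ring_nf

theorem integrable_ambiguity {g : L2} (hg : g ∈ feichtingerAlgebra) :
    Integrable (ambiguity g) := by
  have h : ambiguity g = fun p => phase (-(p.1 * p.2)) * conj (stft g g p) := by
    funext p
    rw [ambiguity_eq, stft_eq_inner, inner_conj_symm]
  have hg' : Integrable (stft g g) := hg
  have hc : Continuous fun p : ℝ × ℝ => phase (-(p.1 * p.2)) := by fun_prop
  have hi : Integrable fun p => conj (stft g g p) :=
    hg'.congr' (Complex.continuous_conj.comp_aestronglyMeasurable hg'.1)
      (Eventually.of_forall fun p => by simp)
  rw [h]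
  exact hi.bdd_mul hc.aestronglyMeasurable (c := 1)
    (Eventually.of_forall fun p => (norm_phase _).le)

theorem continuousAt_ambiguity_zero (g : L2) : ContinuousAt (ambiguity g) 0 := by
  have : Fact ((2 : ℝ≥0∞) ≠ ∞) := ⟨by simp⟩
  have hT (x : ℝ) : tfShift (x, 0) g = DomAddAct.mk (-x) +ᵥ g := by
    refine Lp.ext ?_
    filter_upwards [coeFn_tfShift (x, 0) g, DomAddAct.vadd_Lp_ae_eq (DomAddAct.mk (-x)) g]
      with t h1 h2
    rw [h1, h2]
    simp [tfShiftFun, sub_eq_neg_add]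
  have hM : Continuous fun w : ℝ => (inner ℂ g (tfShift (0, w) g) : ℂ) := by
    simp only [inner_tfShift_right]
    have hi : Integrable fun t => ‖g t‖ ^ 2 := (Lp.memLp g).integrable_norm_pow (by simp)
    refine continuous_of_dominated (bound := fun t => ‖g t‖ ^ 2)
      (fun w => ?_) (fun w => ?_) hi ?_
    · exact (memLp_tfShiftFun _ (Lp.memLp g)).1.mul
        (Complex.continuous_conj.comp_aestronglyMeasurable (Lp.memLp g).1)
    · refine Eventually.of_forall fun t => ?_
      simp only [tfShiftFun, norm_mul, norm_chirp, sub_zero, RCLike.norm_conj, one_mul]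
      rw [sq]
    · refine Eventually.of_forall fun t => ?_
      simp only [tfShiftFun]
      fun_prop
  have hTc : Continuous fun x : ℝ => tfShift (x, 0) g := by
    simp only [hT]
    have : Continuous fun x : ℝ => DomAddAct.mk (-x) := by fun_prop
    fun_prop
  -- Modulation is unitary, so the effect of translation is estimated uniformly in the frequency;
  -- continuity then splits into pure translation and pure modulation.
  have hbound (p : ℝ × ℝ) : ‖(inner ℂ g (tfShift p g) : ℂ) - inner ℂ g (tfShift (0, p.2) g)‖
      ≤ ‖g‖ * ‖tfShift (p.1, 0) g - g‖ := by
    rw [← inner_sub_right]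
    refine (norm_inner_le_norm _ _).trans (le_of_eq ?_)
    congr 1
    refine congrArg ENNReal.toReal (eLpNorm_congr_norm_ae ?_)
    filter_upwards [Lp.coeFn_sub (tfShift p g) (tfShift (0, p.2) g),
      Lp.coeFn_sub (tfShift (p.1, 0) g) g, coeFn_tfShift p g, coeFn_tfShift (0, p.2) g,
      coeFn_tfShift (p.1, 0) g] with t h1 h2 h3 h4 h5
    rw [h1, h2, Pi.sub_apply, Pi.sub_apply, h3, h4, h5]
    simp only [tfShiftFun, ← mul_sub, norm_mul, norm_chirp, sub_zero]
    simp
  have hdiff : Tendsto (fun p : ℝ × ℝ =>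
      (inner ℂ g (tfShift p g) : ℂ) - inner ℂ g (tfShift (0, p.2) g)) (𝓝 0) (𝓝 0) := by
    refine squeeze_zero_norm hbound ?_
    have : Continuous fun p : ℝ × ℝ => ‖g‖ * ‖tfShift (p.1, 0) g - g‖ :=
      continuous_const.mul (((hTc.comp continuous_fst).sub continuous_const).norm)
    convert this.tendsto 0 using 2
    change 0 = ‖g‖ * ‖tfShift 0 g - g‖
    rw [tfShift_zero, sub_self, norm_zero, mul_zero]
  have h2 : Tendsto (fun p : ℝ × ℝ => (inner ℂ g (tfShift (0, p.2) g) : ℂ)) (𝓝 0)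
      (𝓝 (inner ℂ g (tfShift 0 g))) := (hM.comp continuous_snd).tendsto 0
  have h3 : Tendsto (fun p : ℝ × ℝ => phase (-(p.1 * p.2))) (𝓝 0) (𝓝 (phase (-(0 * 0)))) :=
    (show Continuous fun p : ℝ × ℝ => phase (-(p.1 * p.2)) by fun_prop).tendsto 0
  have h4 := h3.mul (hdiff.add h2)
  rw [zero_add] at h4
  simp only [sub_add_cancel, ← ambiguity_eq] at h4
  have h5 : ambiguity g 0 = phase (-(0 * 0)) * inner ℂ g (tfShift 0 g) := ambiguity_eq g 0
  rw [← h5] at h4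
  exact h4

/-! ### The action of `SL(2, ℝ)` on the time-frequency plane -/

/-- The linear map of the time-frequency plane with matrix `S`. -/
noncomputable def planeMap (S : Matrix.SpecialLinearGroup (Fin 2) ℝ) : ℝ × ℝ →ₗ[ℝ] ℝ × ℝ :=
  Matrix.toLin (Module.Basis.finTwoProd ℝ) (Module.Basis.finTwoProd ℝ) S.1

theorem planeMap_apply (S : Matrix.SpecialLinearGroup (Fin 2) ℝ) (p : ℝ × ℝ) :
    planeMap S p = (S.1 0 0 * p.1 + S.1 0 1 * p.2, S.1 1 0 * p.1 + S.1 1 1 * p.2) := by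
  have h : S.1 = !![S.1 0 0, S.1 0 1; S.1 1 0, S.1 1 1] := Matrix.eta_fin_two S.1
  rw [planeMap, h, Matrix.toLin_finTwoProd_apply]
  simp

theorem det_planeMap (S : Matrix.SpecialLinearGroup (Fin 2) ℝ) :
    LinearMap.det (planeMap S) = 1 := by
  rw [planeMap, LinearMap.det_toLin, S.2]

theorem symp_planeMap (S : Matrix.SpecialLinearGroup (Fin 2) ℝ) (p q : ℝ × ℝ) :
    symp (planeMap S p) (planeMap S q) = symp p q := by
  have h := S.2
  rw [Matrix.det_fin_two] at h
  simp only [symp, planeMap_apply]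
  linear_combination (p.1 * q.2 - p.2 * q.1) * h

theorem measurePreserving_planeMap (S : Matrix.SpecialLinearGroup (Fin 2) ℝ) :
    MeasurePreserving (planeMap S) := by
  refine ⟨(planeMap S).continuous_of_finiteDimensional.measurable, ?_⟩
  rw [Measure.map_linearMap_addHaar_eq_smul_addHaar _ (by simp [det_planeMap]), det_planeMap]
  simp

/-- Only surjectivity of `n ↦ S n` onto the lattice is needed, since a lower bound passes to any
larger sum. -/
theorem frameSum_lattice_le (g f : L2) (S : Matrix.SpecialLinearGroup (Fin 2) ℝ) :
    frameSum g (lattice S) f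
      ≤ ∑' n, ‖(inner ℂ (symShift (planeMap S (toPlane n)) g) f : ℂ)‖ₑ ^ 2 := by
  let e : ℤ × ℤ → lattice S := fun n =>
    ⟨planeMap S (toPlane n), n, (planeMap_apply S (toPlane n)).symm⟩
  have he : Function.Surjective e := by
    rintro ⟨_, n, rfl⟩
    exact ⟨n, Subtype.ext (planeMap_apply S (toPlane n))⟩
  refine (ENNReal.tsum_le_tsum_comp_of_surjective he _).trans (le_of_eq (tsum_congr fun n => ?_))
  rw [symShift, inner_smul_left, enorm_mul, conj_phase, ← ofReal_norm (phase _), norm_phase,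
    ENNReal.ofReal_one, one_mul]

/-! ### Vanishing of the lower frame bound -/

theorem eq_zero_of_lower_bound {g : L2} (hg : g ∈ feichtingerAlgebra) (heven : IsEven g)
    (S : Matrix.SpecialLinearGroup (Fin 2) ℝ) {A : ℝ≥0∞} (hA0 : A ≠ 0) (hA : A ≠ ∞)
    (hlow : ∀ f : L2, A * ‖f‖ₑ ^ 2 ≤ frameSum g (lattice S) f) : g = 0 := by
  have hS := measurePreserving_planeMap S
  have hae : ∀ᵐ w, ambiguity g (planeMap S w) = 0 :=
    ae_eq_zero_of_lower_bound (v := fun p => symShift (planeMap S p) g)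
      (fun p q => by rw [inner_symShift, symp_planeMap, map_sub])
      (fun p => by rw [map_neg, ambiguity_neg heven])
      (hS.integrable_comp_of_integrable (integrable_ambiguity hg)) hA0 hA
      (fun f => (hlow f).trans (frameSum_lattice_le g f S))
  have hcont : ContinuousAt (fun w => ambiguity g (planeMap S w)) 0 :=
    ContinuousAt.comp (g := ambiguity g) (by rw [map_zero]; exact continuousAt_ambiguity_zero g)
      (planeMap S).continuous_of_finiteDimensional.continuousAt
  -- A set of full measure is dense, so continuity at `0` carries the zeros to `ambiguity g 0 = ⟨g,
  -- g⟩`.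
  have hmem : ambiguity g (planeMap S 0) ∈ ({0} : Set ℂ) :=
    isClosed_singleton.mem_of_frequently_of_tendsto
      (f := fun w => ambiguity g (planeMap S w))
      (mem_closure_iff_frequently.mp (Measure.dense_of_ae hae 0)) hcont
  rw [Set.mem_singleton_iff, map_zero, ambiguity_eq, tfShift_zero] at hmem
  simpa [phase_ne_zero] using hmem

theorem eq_zero_of_forall_le_frameSum {g : L2} (hg : g ∈ feichtingerAlgebra) (heven : IsEven g)
    (S : Matrix.SpecialLinearGroup (Fin 2) ℝ) {A : ℝ≥0∞}
    (hlow : ∀ f : L2, A * ‖f‖ₑ ^ 2 ≤ frameSum g (lattice S) f) : A = 0 := by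
  by_contra hA0
  -- Truncation at 1 covers the case `A = ∞`, since the preceding argument needs a finite constant.
  have hB0 : min A 1 ≠ 0 := by simp [hA0]
  have hlow' (f : L2) : min A 1 * ‖f‖ₑ ^ 2 ≤ frameSum g (lattice S) f :=
    (mul_le_mul_left (min_le_left A 1) _).trans (hlow f)
  have hg0 := eq_zero_of_lower_bound hg heven S hB0 (by simp) hlow'
  -- A unit vector, on which the frame sum of the zero window contradicts the positive bound.
  set f : L2 := indicatorConstLp 2 (measurableSet_Icc (a := (0 : ℝ)) (b := 1)) (by simp) 1 with hf
  have hfn : ‖f‖ = 1 := by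
    rw [hf, norm_indicatorConstLp (by simp) (by simp)]
    simp
  have h := (hlow' f).trans (frameSum_lattice_le g f S)
  have hz (n : ℤ × ℤ) : (inner ℂ (symShift (planeMap S (toPlane n)) g) f : ℂ) = 0 := by
    have : symShift (planeMap S (toPlane n)) g = 0 := by
      rw [← inner_self_eq_zero (𝕜 := ℂ), inner_symShift, sub_self, ambiguity, hg0,
        inner_zero_left, mul_zero]
    rw [this, inner_zero_left]
  have hfe : ‖f‖ₑ = 1 := by rw [← ofReal_norm, hfn, ENNReal.ofReal_one]
  simp [hz, hfe, hA0] at h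

end Gabor

theorem proposition5p2 (g : Gabor.L2) (hg : g ∈ Gabor.feichtingerAlgebra)
    (heven : Gabor.IsEven g) (S : Matrix.SpecialLinearGroup (Fin 2) ℝ) :
    Gabor.lowerFrameBound g (Gabor.lattice S) = 0 ∧
      ¬ Gabor.IsGaborFrame g (Gabor.lattice S) := by
  refine ⟨?_, ?_⟩
  · refine sSup_eq_bot.mpr ?_
    exact fun A hA => Gabor.eq_zero_of_forall_le_frameSum hg heven S hA
  · rintro ⟨A, B, hA, -, -, h⟩
    exact hA.ne' (Gabor.eq_zero_of_forall_le_frameSum hg heven S fun f => (h f).1)
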